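/- A sum-network is a finite directed acyclic multigraph $(V,E)$ together with nonempty disjoint sets $S,T\subseteq V$ of sources and terminals such that no edge enters a source; each source $s\in S$ generates one symbol $X_s$, and each terminal demands the sum $\sum_{s\in S}X_s$. For a field $F$, a scalar linear code over $F$ consists of coefficients $\alpha_e,\beta_{e',e},\gamma_e\in F$; for source symbols $X_s\in F$ it determines the edge symbols by $Y_e=\alpha_eX_{\mathrm{tail}(e)}$ if $\mathrm{tail}(e)\in S$ and $Y_e=\sum_{e':\,\mathrm{head}(e')=\mathrm{tail}(e)}\beta_{e',e}Y_{e'}$ otherwise. The sum-network is scalar linear solvable over $F$ if for some such code $\sum_{e:\,\mathrm{head}(e)=t}\gamma_eY_e=\sum_{s\in S}X_s$ holds for every $t\in T$ and all $(X_s)_{s\in S}\in F^S$. Theorem. Let $n\ge 0$ and let $P\subseteq\mathbb{Z}[x_1,\dots,x_n]$ be any (finite or infinite) set of polynomials. Then there is a sum-network such that, for every finite field $F$, the sum-network is scalar linear solvable over $F$ if and only if the system $p(x_1,\dots,x_n)=0$ $(p\in P)$ has a solution $(x_1,\dots,x_n)\in F^n$. -/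

import Mathlib

/-- A sum-network on a node set `V` with edge set `E`: a directed acyclic multigraph (parallel edges
are allowed) with nonempty disjoint sets of sources and terminals, in which no edge enters a source.
Each source generates one symbol process, and each terminal demands the sum of all of them. -/
structure SumNetwork (V E : Type*) where
  /-- the node at which an edge starts -/
  tail : E → V
  /-- the node at which an edge ends -/
  head : E → V
  /-- the nodes that generate a symbol -/
  sources : Finset V
  /-- the nodes that demand the sum of all source symbols -/
  terminals : Finset V
  /-- there is no directed cycle -/
  acyclic : ∀ v, ¬ Relation.TransGen (fun a b => ∃ e, tail e = a ∧ head e = b) v v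
  /-- sources have no incoming edge -/
  head_notMem_sources : ∀ e, head e ∉ sources
  sources_nonempty : sources.Nonempty
  terminals_nonempty : terminals.Nonempty
  disjoint_sources_terminals : Disjoint sources terminals

/-- A scalar linear network code over `F`, given by its local coding coefficients. Every edge has
one tail and one head, so that `α` and `γ` are indexed by edges only. -/
structure ScalarLinearCode (E F : Type*) where
  /-- `α e` multiplies the source symbol sent on an edge `e` that leaves a source -/
  α : E → F
  /-- `β e' e` multiplies the symbol of `e'` in the symbol of `e`; it is used only if the head
  of `e'` is the tail of `e` and this node is not a source -/
  β : E → E → F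
  /-- `γ e` multiplies the symbol of `e` in the symbol recovered at the head of `e` -/
  γ : E → F

namespace SumNetwork

variable {V E F : Type*}

open Classical in
/-- The set of edges that enter the node `v`. -/
noncomputable def inEdges [Fintype E] (N : SumNetwork V E) (v : V) : Finset E :=
  Finset.univ.filter (fun e => N.head e = v)

/-- `Y` is the family of symbols carried by the edges when the code `c` is used and each source `s`
generates the symbol `X s` (the values of `X` at other nodes play no role). -/
def IsTransmission [Fintype E] [Field F] (N : SumNetwork V E) (c : ScalarLinearCode E F)
    (X : V → F) (Y : E → F) : Prop :=
  ∀ e, (N.tail e ∈ N.sources → Y e = c.α e * X (N.tail e)) ∧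
    (N.tail e ∉ N.sources → Y e = ∑ e' ∈ N.inEdges (N.tail e), c.β e' e * Y e')

/-- Since the network is acyclic, the source symbols and the code determine the edge symbols. -/
theorem existsUnique_isTransmission [Fintype E] [Field F] (N : SumNetwork V E)
    (c : ScalarLinearCode E F) (X : V → F) : ∃! Y : E → F, N.IsTransmission c X Y := by
  classical
  let r : E → E → Prop := Relation.TransGen (fun e' e => N.head e' = N.tail e)
  have key : ∀ a b, r a b → Relation.TransGen
      (fun a b => ∃ e, N.tail e = a ∧ N.head e = b) (N.tail a) (N.tail b) := by
    intro a b h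
    induction h with
    | single h => exact .single ⟨a, rfl, h⟩
    | tail _ h ih => exact ih.tail ⟨_, rfl, h⟩
  have : IsTrans E r := ⟨fun _ _ _ => Relation.TransGen.trans⟩
  have : Std.Irrefl r := ⟨fun a h => N.acyclic _ (key a a h)⟩
  have wf : WellFounded r := Finite.wellFounded_of_trans_of_irrefl r
  let step : (e : E) → ((e' : E) → r e' e → F) → F := fun e Y =>
    if N.tail e ∈ N.sources then c.α e * X (N.tail e)
    else ∑ e' ∈ (N.inEdges (N.tail e)).attach, c.β e' e *
      Y e' (.single (Finset.mem_filter.1 e'.2).2)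
  have hfix : ∀ e, wf.fix step e = step e (fun e' _ => wf.fix step e') := fun e => wf.fix_eq step e
  refine ⟨wf.fix step, fun e => ⟨fun h => ?_, fun h => ?_⟩, fun Y hY => funext fun e => ?_⟩
  · rw [hfix]
    exact if_pos h
  · rw [hfix]
    refine (if_neg h).trans ?_
    exact Finset.sum_attach (N.inEdges (N.tail e)) (fun e' => c.β e' e * wf.fix step e')
  · induction e using wf.induction with
    | h e ih =>
      rw [hfix]
      by_cases h : N.tail e ∈ N.sources
      · exact ((hY e).1 h).trans (if_pos h).symm
      · refine Eq.trans ?_ (if_neg h).symm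
        rw [(hY e).2 h, ← Finset.sum_attach]
        refine Finset.sum_congr rfl fun e' _ => ?_
        rw [ih e' (.single (Finset.mem_filter.1 e'.2).2)]

/-- The code `c` is a solution: whatever the source symbols are, every terminal recovers their sum
from the symbols on its incoming edges. -/
def IsSolution [Fintype E] [Field F] (N : SumNetwork V E) (c : ScalarLinearCode E F) : Prop :=
  ∀ (X : V → F) (Y : E → F), N.IsTransmission c X Y →
    ∀ t ∈ N.terminals, ∑ e ∈ N.inEdges t, c.γ e * Y e = ∑ s ∈ N.sources, X s

/-- The network has a scalar linear solution over the field `F`. -/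
def ScalarLinearSolvable [Fintype E] (N : SumNetwork V E) (F : Type*) [Field F] : Prop :=
  ∃ c : ScalarLinearCode E F, N.IsSolution c

end SumNetwork

/-! Solutions of the system in `F` are ring homomorphisms to `F` from `R = ℤ[x₁, …, xₙ] / (P)`. By
Hilbert's basis theorem, a map that respects the operations only on a suitable finite `Q ⊆ R`
already yields a solution (`exists_finset_solution`), so a finite network only has to encode the
operations on `Q`.

The network has four sources. Its signals are meant to carry vectors such as `e i + w • e j` with `w
∈ Q`, and its terminals are all tests that succeed for these vectors over `R`. A homomorphism `R →+*
F` carries this realization over `R` to one over `F` (`Realizes.map`). Conversely, in any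
realization over `F` the ratio of the two coefficients of a line signal does not change under
rescaling. The tests force these ratios to respect sums (`ratio_add_ratio_add_ratio`) and products
(`ratio_mul_ratio`), hence to form a partial ring homomorphism on `Q`. -/

/-! ### Signal layouts and their realizations -/

/-- A layout of signals: every signal is computed from source symbols and signals of smaller rank,
and every test has access to some source symbols and signals. -/
structure SignalLayout (Src Sig Test : Type*) where
  /-- the source symbols and signals that a signal or a test has access to -/
  inp : Sig ⊕ Test → Set (Src ⊕ Sig)
  /-- a rank that bounds the depth of a signal -/
  rank : Sig → ℕ
  rank_lt : ∀ {i j}, Sum.inr i ∈ inp (Sum.inl j) → rank i < rank j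

namespace SignalLayout

variable {Src Sig Test : Type*}

/-- The coefficient vectors of source symbols and of signals, the latter given by `f`. -/
def vec [DecidableEq Src] {K : Type*} [CommRing K] (f : Sig → Src → K) : Src ⊕ Sig → Src → K :=
  Sum.elim (fun s => Pi.single s 1) f

/-- The coefficient vectors `f` respect the layout, and every test can compute the all-ones
vector. -/
def Realizes [DecidableEq Src] {K : Type*} [CommRing K] (D : SignalLayout Src Sig Test)
    (f : Sig → Src → K) : Prop :=
  (∀ j, f j ∈ Submodule.span K (vec f '' D.inp (Sum.inl j))) ∧
    ∀ t, (1 : Src → K) ∈ Submodule.span K (vec f '' D.inp (Sum.inr t))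

/-- The edges of the network of a layout: one for every input, and a bottleneck for every signal. -/
abbrev Edge (D : SignalLayout Src Sig Test) := (Σ k, D.inp k) ⊕ Sig

theorem mem_span_image_iff {K ι M : Type*} [CommRing K] [AddCommGroup M] [Module K M]
    (v : ι → M) (s : Set ι) [Fintype s] (x : M) :
    x ∈ Submodule.span K (v '' s) ↔ ∃ c : s → K, ∑ i, c i • v i = x := by
  rw [Set.image_eq_range, Submodule.mem_span_range_iff_exists_fun]

/-- A ring homomorphism carries realizations to realizations. -/
theorem Realizes.map [DecidableEq Src] [Finite Src] [Finite Sig] {K L : Type*} [CommRing K]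
    [CommRing L] {D : SignalLayout Src Sig Test} {f : Sig → Src → K} (hf : D.Realizes f)
    (φ : K →+* L) : D.Realizes (fun j s => φ (f j s)) := by
  classical
  cases nonempty_fintype Src
  cases nonempty_fintype Sig
  have key : ∀ (x : Src → K) (I : Set (Src ⊕ Sig)), x ∈ Submodule.span K (vec f '' I) →
      (fun s => φ (x s)) ∈ Submodule.span L (vec (fun j s => φ (f j s)) '' I) := by
    intro x I hx
    rw [mem_span_image_iff] at hx ⊢
    obtain ⟨c, rfl⟩ := hx
    refine ⟨fun i => φ (c i), funext fun s => ?_⟩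
    simp only [Finset.sum_apply, Pi.smul_apply, smul_eq_mul, map_sum, map_mul]
    refine Finset.sum_congr rfl fun i _ => ?_
    obtain ⟨i | i, hi⟩ := i
    · simp [vec, Pi.single_apply, apply_ite φ]
    · simp [vec]
  refine ⟨fun j => key _ _ (hf.1 j), fun t => ?_⟩
  have := key _ _ (hf.2 t)
  simpa [Pi.one_def] using this

/-! ### The sum-network of a layout: solvability as realizability -/

variable (D : SignalLayout Src Sig Test)

/-- A rank on the nodes of the network of a layout. -/
def nodeRank : (Src ⊕ Sig) ⊕ (Sig ⊕ Test) → WithTop ℕ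
  | .inl (.inl _) => 0
  | .inl (.inr j) => (2 * D.rank j + 2 : ℕ)
  | .inr (.inl j) => (2 * D.rank j + 1 : ℕ)
  | .inr (.inr _) => ⊤

/-- The tail of an edge. -/
def edgeTail : D.Edge → (Src ⊕ Sig) ⊕ (Sig ⊕ Test) :=
  Sum.elim (fun p => .inl p.2) (fun j => .inr (.inl j))

/-- The head of an edge. -/
def edgeHead : D.Edge → (Src ⊕ Sig) ⊕ (Sig ⊕ Test) :=
  Sum.elim (fun p => .inr p.1) (fun j => .inl (.inr j))

theorem nodeRank_lt (e : D.Edge) : D.nodeRank (D.edgeTail e) < D.nodeRank (D.edgeHead e) := by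
  obtain ⟨k | k, i | i, h⟩ | j := e
  · exact WithTop.coe_lt_coe.2 (Nat.succ_pos _)
  · have := D.rank_lt h
    exact Nat.cast_lt.2 (by omega)
  · exact WithTop.coe_lt_top 0
  · exact WithTop.coe_lt_top _
  · exact Nat.cast_lt.2 (by omega)

/-- The sum-network of a layout: the nodes are the places where source symbols and signals are
available and the places where signals and tests collect their inputs. -/
def network [Fintype Src] [Fintype Test] [Nonempty Src] [Nonempty Test] :
    SumNetwork ((Src ⊕ Sig) ⊕ (Sig ⊕ Test)) D.Edge where
  tail := D.edgeTail
  head := D.edgeHead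
  sources := Finset.univ.map (Function.Embedding.inl.trans Function.Embedding.inl)
  terminals := Finset.univ.map (Function.Embedding.inr.trans Function.Embedding.inr)
  acyclic v hv := by
    have : ∀ a b, Relation.TransGen (fun a b => ∃ e, D.edgeTail e = a ∧ D.edgeHead e = b) a b →
        D.nodeRank a < D.nodeRank b := by
      intro a b h
      induction h with
      | single h =>
        obtain ⟨e, rfl, rfl⟩ := h
        exact D.nodeRank_lt e
      | tail _ h ih =>
        obtain ⟨e, rfl, rfl⟩ := h
        exact ih.trans (D.nodeRank_lt e)
    exact lt_irrefl _ (this v v hv)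
  head_notMem_sources e := by
    obtain p | j := e <;> simp [edgeHead]
  sources_nonempty := by simp
  terminals_nonempty := by simp
  disjoint_sources_terminals := by
    rw [Finset.disjoint_left]
    intro a ha hb
    simp only [Finset.mem_map, Finset.mem_univ, true_and] at ha hb
    obtain ⟨s, rfl⟩ := ha
    obtain ⟨t, ht⟩ := hb
    simp at ht

theorem sum_sources [Fintype Src] [Fintype Test] [Nonempty Src] [Nonempty Test]
    {M : Type*} [AddCommMonoid M]
    (h : (Src ⊕ Sig) ⊕ (Sig ⊕ Test) → M) :
    ∑ s ∈ D.network.sources, h s = ∑ s, h (.inl (.inl s)) := by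
  simp [network]

section

variable [Fintype Src] [Fintype Sig] [Fintype Test] [Nonempty Src] [Nonempty Test]
  [∀ k, Fintype (D.inp k)]

theorem sum_inEdges_inr {M : Type*} [AddCommMonoid M] (k : Sig ⊕ Test) (h : D.Edge → M) :
    ∑ e ∈ D.network.inEdges (.inr k), h e = ∑ i : D.inp k, h (.inl ⟨k, i⟩) := by
  classical
  rw [SumNetwork.inEdges, Finset.sum_filter, Fintype.sum_sum_type, Fintype.sum_sigma]
  simp only [network, edgeHead, Sum.elim_inl, Sum.elim_inr, Sum.inr.injEq, reduceCtorEq,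
    if_false, Finset.sum_const_zero, add_zero]
  rw [Finset.sum_eq_single k]
  · simp
  · intro b _ hb
    simp [hb]
  · simp

theorem sum_inEdges_inl {M : Type*} [AddCommMonoid M] (j : Sig) (h : D.Edge → M) :
    ∑ e ∈ D.network.inEdges (.inl (.inr j)), h e = h (.inr j) := by
  classical
  rw [SumNetwork.inEdges, Finset.sum_filter, Fintype.sum_sum_type]
  simp [network, edgeHead]

theorem isTransmission_iff {F : Type*} [Field F] (c : ScalarLinearCode D.Edge F)
    (X : (Src ⊕ Sig) ⊕ (Sig ⊕ Test) → F) (Y : D.Edge → F) :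
    D.network.IsTransmission c X Y ↔
      (∀ k s h, Y (.inl ⟨k, .inl s, h⟩) = c.α (.inl ⟨k, .inl s, h⟩) * X (.inl (.inl s))) ∧
      (∀ k j h, Y (.inl ⟨k, .inr j, h⟩) =
        c.β (.inr j) (.inl ⟨k, .inr j, h⟩) * Y (.inr j)) ∧
      ∀ j, Y (.inr j) = ∑ i : D.inp (.inl j),
        c.β (.inl ⟨.inl j, i⟩) (.inr j) * Y (.inl ⟨.inl j, i⟩) := by
  constructor
  · intro H
    refine ⟨fun k s h => (H _).1 ?_, fun k j h => ?_, fun j => ?_⟩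
    · simp [network, edgeTail]
    · rw [(H _).2 (by simp [network, edgeTail])]
      exact D.sum_inEdges_inl j _
    · rw [(H _).2 (by simp [network, edgeTail])]
      exact D.sum_inEdges_inr (.inl j) _
  · rintro ⟨h₁, h₂, h₃⟩ (⟨k, s | j, h⟩ | j)
    · exact ⟨fun _ => h₁ k s h, fun h' => absurd (by simp [network, edgeTail]) h'⟩
    · refine ⟨fun h' => absurd h' (by simp [network, edgeTail]), fun _ => ?_⟩
      rw [h₂]
      exact (D.sum_inEdges_inl j fun e => c.β e (.inl ⟨k, .inr j, h⟩) * Y e).symm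
    · refine ⟨fun h' => absurd h' (by simp [network, edgeTail]), fun _ => ?_⟩
      rw [h₃]
      exact (D.sum_inEdges_inr (.inl j) fun e => c.β e (.inr j) * Y e).symm

theorem isSolution_iff {F : Type*} [Field F] (c : ScalarLinearCode D.Edge F) :
    D.network.IsSolution c ↔ ∀ X Y, D.network.IsTransmission c X Y → ∀ t,
      ∑ i : D.inp (.inr t), c.γ (.inl ⟨.inr t, i⟩) * Y (.inl ⟨.inr t, i⟩) =
        ∑ s, X (.inl (.inl s)) := by
  have h : ∀ v, v ∈ D.network.terminals ↔ ∃ t, v = .inr (.inr t) := fun v => by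
    simp [network, eq_comm]
  simp only [SumNetwork.IsSolution, h, forall_exists_index, forall_eq_apply_imp_iff,
    sum_inEdges_inr, sum_sources]

/-- By linearity it suffices to run the code on unit inputs: the responses of the bottleneck edge of
a signal are its coefficient vector. -/
theorem exists_realizes_of_isSolution [DecidableEq Src] {F : Type*} [Field F]
    {c : ScalarLinearCode D.Edge F} (hc : D.network.IsSolution c) :
    ∃ f : Sig → Src → F, D.Realizes f := by
  rw [isSolution_iff] at hc
  let X : Src → (Src ⊕ Sig) ⊕ (Sig ⊕ Test) → F := fun s =>
    Sum.elim (Sum.elim (Pi.single s 1) 0) 0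
  choose Y hY _ using fun s => D.network.existsUnique_isTransmission c (X s)
  -- The gain of an input edge, which may rescale what it carries.
  let δ : ∀ k, D.inp k → F := fun k i => match i with
    | ⟨.inl s, h⟩ => c.α (.inl ⟨k, .inl s, h⟩)
    | ⟨.inr j, h⟩ => c.β (.inr j) (.inl ⟨k, .inr j, h⟩)
  let f : Sig → Src → F := fun j s => Y s (.inr j)
  have hδ : ∀ s k (i : D.inp k), Y s (.inl ⟨k, i⟩) = δ k i * vec f i s := by
    rintro s k ⟨s' | j, h⟩
    · rw [((D.isTransmission_iff c _ _).1 (hY s)).1]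
      simp [δ, vec, X, Pi.single_apply, eq_comm]
    · exact ((D.isTransmission_iff c _ _).1 (hY s)).2.1 k j h
  refine ⟨f, fun j => ?_, fun t => ?_⟩
  · rw [mem_span_image_iff]
    refine ⟨fun i => c.β (.inl ⟨.inl j, i⟩) (.inr j) * δ _ i, funext fun s => ?_⟩
    refine Eq.trans ?_ (((D.isTransmission_iff c _ _).1 (hY s)).2.2 j).symm
    simp only [Finset.sum_apply, Pi.smul_apply, smul_eq_mul, hδ, mul_assoc]
  · rw [mem_span_image_iff]
    refine ⟨fun i => c.γ (.inl ⟨.inr t, i⟩) * δ _ i, funext fun s => ?_⟩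
    have := hc _ _ (hY s) t
    simp only [hδ] at this
    simpa [X, mul_assoc] using this

theorem Realizes.scalarLinearSolvable [DecidableEq Src] {F : Type*} [Field F]
    {f : Sig → Src → F} (hf : D.Realizes f) : D.network.ScalarLinearSolvable F := by
  have h₁ := hf.1
  have h₂ := hf.2
  simp only [mem_span_image_iff] at h₁ h₂
  choose g hg using h₁
  choose g' hg' using h₂
  let γ : (Σ k, D.inp k) → F := fun p => match p with
    | ⟨.inl j, i⟩ => g j i
    | ⟨.inr t, i⟩ => g' t i
  -- Input edges forward unchanged; the span coefficients are applied only where a signal or a test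
  -- collects its inputs.
  refine ⟨⟨1, fun e e' => Sum.elim (fun p => Sum.elim 1 (fun _ => γ p) e') 1 e,
    Sum.elim γ 1⟩, (D.isSolution_iff _).2 fun X Y hY t => ?_⟩
  obtain ⟨hs, hj, hY⟩ := (D.isTransmission_iff _ _ _).1 hY
  simp only [Pi.one_apply, one_mul, Sum.elim_inl, Sum.elim_inr] at hs hj hY ⊢
  have hsum : ∀ k, (∀ j, .inr j ∈ D.inp k → Y (.inr j) = ∑ s, f j s * X (.inl (.inl s))) →
      ∑ i : D.inp k, γ ⟨k, i⟩ * Y (.inl ⟨k, i⟩) =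
        ∑ s, (∑ i : D.inp k, γ ⟨k, i⟩ • vec f i) s * X (.inl (.inl s)) := by
    intro k hk
    have : ∀ i : D.inp k, Y (.inl ⟨k, i⟩) = ∑ s, vec f i s * X (.inl (.inl s)) := by
      rintro ⟨s | j, h⟩
      · simp [hs, vec, Pi.single_apply]
      · rw [hj, hk j h]
        rfl
    simp only [this, Finset.sum_apply, Pi.smul_apply, smul_eq_mul, Finset.mul_sum,
      Finset.sum_mul, mul_assoc]
    exact Finset.sum_comm
  have hind : ∀ n j, D.rank j < n → Y (.inr j) = ∑ s, f j s * X (.inl (.inl s)) := by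
    intro n
    induction n with
    | zero => exact fun j h => absurd h (Nat.not_lt_zero _)
    | succ n ih =>
      intro j h
      rw [hY, hsum (.inl j) fun i hi => ih i (by have := D.rank_lt hi; omega)]
      simp only [γ, hg]
  rw [hsum (.inr t) fun j _ => hind _ j (Nat.lt_succ_self _)]
  simp only [γ, hg', Pi.one_apply, one_mul]

end

end SignalLayout


/-! ### Signals and tests that encode arithmetic -/

/-- The signals that are available for a type `W` of scalars, over four sources: `line i j w`
stands for `e i + w • e j`, and `plane i k l v w` stands for `e i + v • (e k + w • e l)`. -/
inductive ArithSignal (W : Type*)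
  | line (i j : Fin 4) (w : W)
  | plane (i k l : Fin 4) (v w : W)

namespace ArithSignal

open SignalLayout

variable {W : Type*}

instance [Finite W] : Finite (ArithSignal W) :=
  Finite.of_surjective (α := (Fin 4 × Fin 4 × W) ⊕ (Fin 4 × Fin 4 × Fin 4 × W × W))
    (Sum.elim (fun p => line p.1 p.2.1 p.2.2)
      (fun p => plane p.1 p.2.1 p.2.2.1 p.2.2.2.1 p.2.2.2.2)) (by
    rintro (⟨i, j, w⟩ | ⟨i, k, l, v, w⟩)
    · exact ⟨.inl (i, j, w), rfl⟩
    · exact ⟨.inr (i, k, l, v, w), rfl⟩)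

/-- The inputs of a signal. -/
def inputs : ArithSignal W → Set (Fin 4 ⊕ ArithSignal W)
  | line i j _ => {.inl i, .inl j}
  | plane i k l _ w => {.inl i, .inr (line k l w)}

/-- The number of signals below a signal. -/
def depth : ArithSignal W → ℕ
  | line _ _ _ => 0
  | plane _ _ _ _ _ => 1

/-- The intended coefficient vectors of the signals, if the scalars take the values `val`. -/
def generic {R : Type*} [CommRing R] (val : W → R) : ArithSignal W → Fin 4 → R
  | line i j w => Pi.single i 1 + val w • Pi.single j 1
  | plane i k l v w => Pi.single i 1 + val v • (Pi.single k 1 + val w • Pi.single l 1)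

/-- A test on a set `p.1` of signals and a set `p.2` of sources has access to the signals in `p.1`
and to the source symbols outside `p.2`. -/
def testInputs (p : Set (ArithSignal W) × Set (Fin 4)) : Set (Fin 4 ⊕ ArithSignal W) :=
  Sum.inl '' p.2ᶜ ∪ Sum.inr '' p.1

/-- The source symbols given to the test correct every coordinate outside `p.2` freely, so the
signals are constrained on `p.2` only. -/
theorem one_mem_span_testInputs_iff {K : Type*} [CommRing K] (f : ArithSignal W → Fin 4 → K)
    (p : Set (ArithSignal W) × Set (Fin 4)) :
    (1 : Fin 4 → K) ∈ Submodule.span K (vec f '' testInputs p) ↔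
      ∃ x ∈ Submodule.span K (f '' p.1), ∀ s ∈ p.2, x s = 1 := by
  have h : ∀ y : Fin 4 → K,
      y ∈ Submodule.span K ((fun i : Fin 4 => (Pi.single i 1 : Fin 4 → K)) '' p.2ᶜ) ↔
        ∀ s ∈ p.2, y s = 0 := by
    intro y
    constructor
    · intro hy s hs
      induction hy using Submodule.span_induction with
      | mem x hx =>
        obtain ⟨i, hi, rfl⟩ := hx
        exact Pi.single_eq_of_ne (fun h : s = i => hi (h ▸ hs)) _
      | zero => rfl
      | add x y _ _ hx hy => simp [hx, hy]
      | smul a x _ hx => simp [hx]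
    · intro hy
      have : y = ∑ i, y i • (Pi.single i 1 : Fin 4 → K) := by
        funext s
        simp [Pi.single_apply]
      rw [this]
      refine Submodule.sum_mem _ fun i _ => ?_
      by_cases hi : i ∈ p.2
      · simp [hy i hi]
      · exact Submodule.smul_mem _ _ (Submodule.subset_span ⟨i, hi, rfl⟩)
  have hvec : vec f '' testInputs p =
      (fun i : Fin 4 => (Pi.single i 1 : Fin 4 → K)) '' p.2ᶜ ∪ f '' p.1 := by
    rw [testInputs, Set.image_union, Set.image_image, Set.image_image]
    rfl
  rw [hvec, Submodule.span_union, Submodule.mem_sup]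
  simp only [h]
  constructor
  · rintro ⟨y, hy, x, hx, hxy⟩
    refine ⟨x, hx, fun s hs => ?_⟩
    simpa [hy s hs] using congrFun hxy s
  · rintro ⟨x, hx, h⟩
    exact ⟨1 - x, fun s hs => by simp [h s hs], x, hx, by simp⟩

/-- The tests that succeed for the intended coefficient vectors. -/
def tests {R : Type*} [CommRing R] (val : W → R) : Set (Set (ArithSignal W) × Set (Fin 4)) :=
  {p | ∃ x ∈ Submodule.span R (generic val '' p.1), ∀ s ∈ p.2, x s = 1}

/-- The layout that has all tests that succeed for the intended coefficient vectors. -/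
def layout {R : Type*} [CommRing R] (val : W → R) :
    SignalLayout (Fin 4) (ArithSignal W) (tests val) where
  inp := Sum.elim inputs fun p => testInputs p.1
  rank := depth
  rank_lt := by
    rintro i (_ | _) h <;> simp_all [inputs, depth]

theorem realizes_generic {R : Type*} [CommRing R] (val : W → R) :
    (layout val).Realizes (generic val) := by
  refine ⟨fun j => ?_, fun t => (one_mem_span_testInputs_iff _ _).2 t.2⟩
  cases j with
  | line i j w =>
    simp only [layout, inputs, Sum.elim_inl, Set.image_pair]
    exact Submodule.mem_span_pair.2 ⟨1, val w, by simp [vec, generic]⟩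
  | plane i k l v w =>
    simp only [layout, inputs, Sum.elim_inl, Set.image_pair]
    exact Submodule.mem_span_pair.2 ⟨1, val v, by simp [vec, generic]⟩

theorem nonempty_tests {R : Type*} [CommRing R] (val : W → R) : Nonempty (tests val) :=
  ⟨⟨(∅, ∅), 0, by simp, by simp⟩⟩

/-! ### Relations between ratios forced by the tests -/

section Realization

variable {R F : Type*} [CommRing R] [Field F] {val : W → R} {f : ArithSignal W → Fin 4 → F}

/-- The ratio of the two coefficients of the signal `line i j w`. -/
def ratio (f : ArithSignal W → Fin 4 → F) (i j : Fin 4) (w : W) : F :=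
  f (line i j w) j / f (line i j w) i

theorem exists_of_test (hf : (layout val).Realizes f) {U : Set (ArithSignal W)}
    {A : Set (Fin 4)} (h : (U, A) ∈ tests val) :
    ∃ x ∈ Submodule.span F (f '' U), ∀ s ∈ A, x s = 1 :=
  (one_mem_span_testInputs_iff f (U, A)).1 (hf.2 ⟨(U, A), h⟩)

theorem line_apply_eq_zero (hf : (layout val).Realizes f) {i j s : Fin 4} (w : W) (hi : s ≠ i)
    (hj : s ≠ j) : f (line i j w) s = 0 := by
  have := hf.1 (line i j w)
  simp only [layout, inputs, Sum.elim_inl, Set.image_pair] at this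
  obtain ⟨a, b, h⟩ := Submodule.mem_span_pair.1 this
  simp [← h, vec, hi, hj]

theorem ratio_eq_one (hf : (layout val).Realizes f) {i j : Fin 4} (hij : i ≠ j) {w : W}
    (hw : val w = 1) : f (line i j w) i ≠ 0 ∧ ratio f i j w = 1 := by
  have ht : (({line i j w}, {i, j}) : Set (ArithSignal W) × Set (Fin 4)) ∈ tests val := by
    refine ⟨_, Submodule.subset_span ⟨_, rfl, rfl⟩, ?_⟩
    simp [generic, hw, hij, hij.symm]
  obtain ⟨x, hx, h⟩ := exists_of_test hf ht
  rw [Set.image_singleton, Submodule.mem_span_singleton] at hx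
  obtain ⟨a, rfl⟩ := hx
  simp only [Set.mem_insert_iff, Set.mem_singleton_iff, forall_eq_or_imp, forall_eq, Pi.smul_apply,
    smul_eq_mul] at h
  obtain ⟨h₁, h₂⟩ := h
  have hi : f (line i j w) i ≠ 0 := right_ne_zero_of_mul_eq_one h₁
  have ha : a ≠ 0 := left_ne_zero_of_mul_eq_one h₁
  exact ⟨hi, (div_eq_one_iff_eq hi).2 (mul_left_cancel₀ ha (h₂.trans h₁.symm))⟩

/-- A test on two signals with separate pivots `i` and `k` forces a sum of two ratios to be one. -/
theorem div_add_div_eq_one (hf : (layout val).Realizes f) {x y : ArithSignal W} {i k j : Fin 4}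
    (hxk : f x k = 0) (hyi : f y i = 0) (ht : ({x, y}, {i, k, j}) ∈ tests val) :
    f x i ≠ 0 ∧ f y k ≠ 0 ∧ f x j / f x i + f y j / f y k = 1 := by
  obtain ⟨z, hz, h⟩ := exists_of_test hf ht
  rw [Set.image_pair, Submodule.mem_span_pair] at hz
  obtain ⟨a, b, rfl⟩ := hz
  simp only [Set.mem_insert_iff, Set.mem_singleton_iff, forall_eq_or_imp, forall_eq, Pi.smul_apply,
    Pi.add_apply, smul_eq_mul, hxk, hyi, mul_zero, add_zero, zero_add] at h
  obtain ⟨h₁, h₂, h₃⟩ := h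
  have hx := right_ne_zero_of_mul_eq_one h₁
  have hy := right_ne_zero_of_mul_eq_one h₂
  refine ⟨hx, hy, ?_⟩
  rw [← h₃, eq_div_of_mul_eq hx h₁, eq_div_of_mul_eq hy h₂]
  ring

/-- Coordinates `i` and `k` fix the multipliers of the two signals, and coordinate `j` then compares
their ratios. -/
theorem ratio_add_ratio (hf : (layout val).Realizes f) {i k j : Fin 4} (hij : i ≠ j) (hkj : k ≠ j)
    (hik : i ≠ k) {v w : W} (hvw : val v + val w = 1) :
    f (line i j v) i ≠ 0 ∧ ratio f i j v + ratio f k j w = 1 := by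
  have := div_add_div_eq_one hf (x := line i j v) (y := line k j w) (i := i) (k := k) (j := j)
    (line_apply_eq_zero hf _ hik.symm hkj) (line_apply_eq_zero hf _ hik hij) (by
      refine ⟨_, Submodule.mem_span_pair (R := R) (x := generic val (line i j v))
        (y := generic val (line k j w)) |>.2 ⟨1, 1, rfl⟩ |> fun h => by
          rwa [Set.image_pair], ?_⟩
      simp [generic, hij, hkj, hik, hij.symm, hkj.symm, hik.symm, hvw])
  exact ⟨this.1, this.2.2⟩

/-- The source of addition: three lines with distinct pivots meet in coordinate 2. -/
theorem ratio_add_ratio_add_ratio (hf : (layout val).Realizes f) {u v w : W}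
    (h : val u + val v + val w = 1) : ratio f 0 2 u + ratio f 1 2 v + ratio f 3 2 w = 1 := by
  have ht : (({line 0 2 u, line 1 2 v, line 3 2 w}, Set.univ) :
      Set (ArithSignal W) × Set (Fin 4)) ∈ tests val := by
    refine ⟨generic val (line 0 2 u) + generic val (line 1 2 v) + generic val (line 3 2 w),
      Submodule.add_mem _ (Submodule.add_mem _ ?_ ?_) ?_, ?_⟩
    iterate 3 exact Submodule.subset_span ⟨_, by simp, rfl⟩
    intro s _
    fin_cases s <;> simp [generic, h]
  obtain ⟨x, hx, h⟩ := exists_of_test hf ht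
  rw [Set.image_insert_eq, Set.image_pair, Submodule.mem_span_triple] at hx
  obtain ⟨a, b, c, rfl⟩ := hx
  have h₀ := h 0 trivial
  have h₁ := h 1 trivial
  have h₂ := h 2 trivial
  have h₃ := h 3 trivial
  simp only [Pi.add_apply, Pi.smul_apply, smul_eq_mul,
    line_apply_eq_zero hf _ (show (0 : Fin 4) ≠ 1 by decide) (show (0 : Fin 4) ≠ 2 by decide),
    line_apply_eq_zero hf _ (show (0 : Fin 4) ≠ 3 by decide) (show (0 : Fin 4) ≠ 2 by decide),
    line_apply_eq_zero hf _ (show (1 : Fin 4) ≠ 0 by decide) (show (1 : Fin 4) ≠ 2 by decide),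
    line_apply_eq_zero hf _ (show (1 : Fin 4) ≠ 3 by decide) (show (1 : Fin 4) ≠ 2 by decide),
    line_apply_eq_zero hf _ (show (3 : Fin 4) ≠ 0 by decide) (show (3 : Fin 4) ≠ 2 by decide),
    line_apply_eq_zero hf _ (show (3 : Fin 4) ≠ 1 by decide) (show (3 : Fin 4) ≠ 2 by decide),
    mul_zero, add_zero, zero_add] at h₀ h₁ h₂ h₃
  rw [← h₂, eq_div_of_mul_eq (right_ne_zero_of_mul_eq_one h₀) h₀,
    eq_div_of_mul_eq (right_ne_zero_of_mul_eq_one h₁) h₁,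
    eq_div_of_mul_eq (right_ne_zero_of_mul_eq_one h₃) h₃, ratio, ratio, ratio]
  ring

/-- The signal `plane 0 2 3 v w` carries the product of `v` and `w`. -/
theorem ratio_mul_ratio (hf : (layout val).Realizes f) {v v' w w' c : W}
    (hv : val v + val v' = 1) (hw : val w + val w' = 1) (hc : val v * val w + val c = 1) :
    (1 - ratio f 1 2 v') * ratio f 2 3 w + ratio f 1 3 c = 1 := by
  have hspan := hf.1 (plane 0 2 3 v w)
  simp only [layout, inputs, Sum.elim_inl, Set.image_pair] at hspan
  obtain ⟨a, b, h⟩ := Submodule.mem_span_pair.1 hspan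
  have h1 : f (plane 0 2 3 v w) 1 = 0 := by
    simp [← h, vec, line_apply_eq_zero hf w (show (1 : Fin 4) ≠ 2 by decide)
      (show (1 : Fin 4) ≠ 3 by decide)]
  have h2 : f (plane 0 2 3 v w) 2 = b * f (line 2 3 w) 2 := by simp [← h, vec]
  have h3 : f (plane 0 2 3 v w) 3 = b * f (line 2 3 w) 3 := by simp [← h, vec]
  have ht : ∀ (j : Fin 4) (u : W),
      j ≠ 0 → j ≠ 1 → generic val (plane 0 2 3 v w) j + val u = 1 →
      (({plane 0 2 3 v w, line 1 j u}, {0, 1, j}) : Set (ArithSignal W) × Set (Fin 4)) ∈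
        tests val := by
    intro j u hj0 hj1 hu
    refine ⟨generic val (plane 0 2 3 v w) + generic val (line 1 j u),
      Submodule.add_mem _ (Submodule.subset_span ⟨_, by simp, rfl⟩)
        (Submodule.subset_span ⟨_, by simp, rfl⟩), ?_⟩
    simp only [Set.mem_insert_iff, Set.mem_singleton_iff, forall_eq_or_imp, forall_eq]
    refine ⟨?_, ?_, ?_⟩
    · simp [generic, hj0.symm]
    · simp [generic, hj1.symm]
    · rw [← hu]
      simp [generic, hj1]
  have e₂ := (div_add_div_eq_one hf h1 (line_apply_eq_zero hf _ (by decide) (by decide))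
    (ht 2 v' (by decide) (by decide) (by simpa [generic] using hv))).2.2
  have e₃ := (div_add_div_eq_one hf h1 (line_apply_eq_zero hf _ (by decide) (by decide))
    (ht 3 c (by decide) (by decide) (by simpa [generic] using hc))).2.2
  -- This is the only use of `w'`: the quotient defining `ratio f 2 3 w` must not be the default
  -- value of a division by zero.
  have hne : f (line 2 3 w) 2 ≠ 0 :=
    (ratio_add_ratio hf (i := 2) (k := 1) (by decide) (by decide) (by decide) hw).1
  rw [ratio, ratio, ratio, ← eq_sub_of_add_eq e₂, h2]
  refine Eq.trans ?_ e₃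
  rw [h3]
  field_simp

end Realization

end ArithSignal

-- Partial ring homomorphisms and polynomial systems

universe u

/-- The map `y` respects the ring operations as far as they do not lead out of `Q`. -/
structure IsPartialRingHom {R F : Type*} [CommRing R] [CommRing F] (Q : Set R) (y : R → F) :
    Prop where
  map_one : y 1 = 1
  map_add : ∀ a ∈ Q, ∀ b ∈ Q, a + b ∈ Q → y (a + b) = y a + y b
  map_mul : ∀ a ∈ Q, ∀ b ∈ Q, a * b ∈ Q → y (a * b) = y a * y b

namespace IsPartialRingHom

variable {R F : Type*} [CommRing R] [CommRing F] {Q Q' : Set R} {y : R → F}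

theorem mono (h : IsPartialRingHom Q' y) (hQ : Q ⊆ Q') : IsPartialRingHom Q y :=
  ⟨h.map_one, fun a ha b hb hab => h.map_add a (hQ ha) b (hQ hb) (hQ hab),
    fun a ha b hb hab => h.map_mul a (hQ ha) b (hQ hb) (hQ hab)⟩

theorem map_zero (h : IsPartialRingHom Q y) (h0 : (0 : R) ∈ Q) : y 0 = 0 := by
  have := h.map_add 0 h0 0 h0 (by simpa using h0)
  simpa using this

end IsPartialRingHom

/-- A partial ring homomorphism on a suitable finite set evaluates a given polynomial correctly. -/
theorem exists_finset_aeval {σ R : Type*} [CommRing R] (g : MvPolynomial σ ℤ →+* R)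
    (p : MvPolynomial σ ℤ) :
    ∃ Q : Finset R, ∀ (F : Type u) [Field F] (y : R → F), IsPartialRingHom (Q : Set R) y →
      y (g p) = MvPolynomial.aeval (fun i => y (g (MvPolynomial.X i))) p := by
  classical
  induction p using MvPolynomial.induction_on with
  | C a =>
    induction a using Int.induction_on with
    | zero => exact ⟨{0}, fun F _ y hy => by simpa using hy.map_zero (by simp)⟩
    | succ n ih =>
      obtain ⟨Q, hQ⟩ := ih
      refine ⟨Q ∪ {g (.C (n : ℤ)), 1, g (.C (n : ℤ)) + 1}, fun F _ y hy => ?_⟩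
      rw [MvPolynomial.C_add, map_add, map_add, ← hQ F y (hy.mono fun a ha => by simp_all), MvPolynomial.C_1,
        map_one, map_one, hy.map_add _ (by simp) _ (by simp) (by simp), hy.map_one]
    | pred n ih =>
      obtain ⟨Q, hQ⟩ := ih
      refine ⟨Q ∪ {g (.C (-n : ℤ)), 1, g (.C (-n : ℤ)) - 1}, fun F _ y hy => ?_⟩
      -- Subtraction is not among the preserved operations, so it is read off from adding 1 back.
      have := hy.map_add (g (.C (-n : ℤ)) - 1) (by simp) 1 (by simp) (by simp)
      rw [MvPolynomial.C_sub, map_sub, map_sub, ← hQ F y (hy.mono fun a ha => by simp_all), MvPolynomial.C_1,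
        map_one, map_one, eq_sub_iff_add_eq, ← hy.map_one, ← this, sub_add_cancel]
  | add p q hp hq =>
    obtain ⟨Q, hQ⟩ := hp
    obtain ⟨Q', hQ'⟩ := hq
    refine ⟨Q ∪ Q' ∪ {g p, g q, g p + g q}, fun F _ y hy => ?_⟩
    rw [map_add, map_add, hy.map_add _ (by simp) _ (by simp) (by simp),
      hQ F y (hy.mono fun a ha => by simp_all), hQ' F y (hy.mono fun a ha => by simp_all)]
  | mul_X p i hp =>
    obtain ⟨Q, hQ⟩ := hp
    refine ⟨Q ∪ {g p, g (.X i), g p * g (.X i)}, fun F _ y hy => ?_⟩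
    rw [map_mul, map_mul, hy.map_mul _ (by simp) _ (by simp) (by simp),
      hQ F y (hy.mono fun a ha => by simp_all), MvPolynomial.aeval_X]

/-- A partial ring homomorphism on a suitable finite subset of the coordinate ring of a system of
polynomial equations yields a solution of the system. -/
theorem exists_finset_solution {n : ℕ} (P : Set (MvPolynomial (Fin n) ℤ)) :
    ∃ Q : Finset (MvPolynomial (Fin n) ℤ ⧸ Ideal.span P), ∀ (F : Type u) [Field F]
      (y : MvPolynomial (Fin n) ℤ ⧸ Ideal.span P → F), IsPartialRingHom (Q : Set _) y →
      ∃ x : Fin n → F, ∀ p ∈ P, MvPolynomial.aeval x p = 0 := by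
  classical
  -- Finitely many generators suffice, since the polynomials vanishing at a point form an ideal.
  obtain ⟨G, hG⟩ := IsNoetherian.noetherian (Ideal.span P)
  choose Q hQ using exists_finset_aeval.{u} (Ideal.Quotient.mk (Ideal.span P))
  refine ⟨insert 0 (G.biUnion Q), fun F _ y hy =>
    ⟨fun i => y (Ideal.Quotient.mk _ (.X i)), fun p hp => ?_⟩⟩
  have hle : Ideal.span P ≤ RingHom.ker (MvPolynomial.aeval
      fun i => y (Ideal.Quotient.mk (Ideal.span P) (.X i))) := by
    refine hG.symm.trans_le (Ideal.span_le.2 fun q hq => ?_)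
    have hqG : Ideal.Quotient.mk (Ideal.span P) q = 0 :=
      Ideal.Quotient.eq_zero_iff_mem.2 (hG ▸ Ideal.subset_span hq)
    rw [SetLike.mem_coe, RingHom.mem_ker, ← hQ q F y (hy.mono fun a ha => ?_), hqG,
      hy.map_zero (by simp)]
    simp only [Finset.coe_insert, Finset.coe_biUnion, Set.mem_insert_iff, Set.mem_iUnion]
    exact Or.inr ⟨q, hq, ha⟩
  exact hle (Ideal.subset_span hp)

/-! ### From realizations to solutions, and the theorem -/

open ArithSignal in
/-- The ratios of the signals in a realization form a partial ring homomorphism. -/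
theorem ArithSignal.exists_isPartialRingHom {R F : Type*} [CommRing R] [Field F] {Q : Set R}
    (h1 : 1 ∈ Q) (hQ : ∀ a ∈ Q, 1 - a ∈ Q) {f : ArithSignal Q → Fin 4 → F}
    (hf : (layout ((↑) : Q → R)).Realizes f) : ∃ y : R → F, IsPartialRingHom Q y := by
  classical
  let c : Q → Q := fun a => ⟨1 - a, hQ a a.2⟩
  have hc : ∀ a : Q, (a : R) + c a = 1 := fun a => add_sub_cancel _ _
  have hc' : ∀ a : Q, (c a : R) + a = 1 := fun a => sub_add_cancel _ _
  have h01 : ∀ a b : Q, (a : R) + b = 1 → ratio f 0 2 a + ratio f 1 2 b = 1 := fun a b h =>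
    (ratio_add_ratio hf (by decide) (by decide) (by decide) h).2
  have h13 : ∀ a b : Q, (a : R) + b = 1 → ratio f 1 2 a + ratio f 3 2 b = 1 := fun a b h =>
    (ratio_add_ratio hf (by decide) (by decide) (by decide) h).2
  have h03 : ∀ a b : Q, (a : R) + b = 1 → ratio f 0 2 a + ratio f 3 2 b = 1 := fun a b h =>
    (ratio_add_ratio hf (by decide) (by decide) (by decide) h).2
  have h21 : ∀ a b : Q, (a : R) + b = 1 → ratio f 2 3 a + ratio f 1 3 b = 1 := fun a b h =>
    (ratio_add_ratio hf (by decide) (by decide) (by decide) h).2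
  -- Two ratios complementary to the same third one agree; this is why three pivots besides
  -- coordinate 2 are needed.
  have e3 : ∀ a, ratio f 3 2 a = ratio f 0 2 a := fun a => by
    linear_combination h13 (c a) a (hc' a) - h01 a (c a) (hc a)
  have e1 : ∀ a, ratio f 1 2 a = ratio f 0 2 a := fun a => by
    linear_combination h13 a (c a) (hc a) - h03 a (c a) (hc a)
  have hmul : ∀ a b d : Q, (a : R) * b + d = 1 →
      ratio f 0 2 a * ratio f 2 3 b + ratio f 1 3 d = 1 := fun a b d h => by
    have := ratio_mul_ratio hf (hc a) (hc b) h
    rwa [← eq_sub_of_add_eq (h01 a (c a) (hc a))] at this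
  have e13 : ∀ a, ratio f 1 3 a = ratio f 0 2 a := fun a => by
    -- Multiplication by 1 transports ratios from coordinate 2 to coordinate 3.
    have h₁ := hmul (c a) ⟨1, h1⟩ a (by simpa using hc' a)
    rw [(ratio_eq_one hf (i := 2) (j := 3) (by decide) (w := ⟨1, h1⟩) rfl).2] at h₁
    have h₂ := h01 (c a) a (hc' a)
    rw [e1] at h₂
    linear_combination h₁ - h₂
  have e23 : ∀ a, ratio f 2 3 a = ratio f 0 2 a := fun a => by
    have h₁ := h21 a (c a) (hc a)
    have h₂ := h01 a (c a) (hc a)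
    rw [e13] at h₁
    rw [e1] at h₂
    linear_combination h₁ - h₂
  have hadd : ∀ a : Q, ratio f 0 2 a + ratio f 0 2 (c a) = 1 := fun a => by
    rw [← h01 a (c a) (hc a), e1]
  refine ⟨fun a => if h : a ∈ Q then ratio f 0 2 ⟨a, h⟩ else 0, ?_, ?_, ?_⟩
  · simp only [h1, dif_pos]
    exact (ratio_eq_one hf (by decide) rfl).2
  · intro a ha b hb hab
    simp only [ha, hb, hab, dif_pos]
    have h₁ := ratio_add_ratio_add_ratio hf (u := ⟨a, ha⟩) (v := ⟨b, hb⟩) (w := c ⟨a + b, hab⟩)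
      (add_sub_cancel (a + b) 1)
    rw [e1, e3] at h₁
    linear_combination hadd ⟨a + b, hab⟩ - h₁
  · intro a ha b hb hab
    simp only [ha, hb, hab, dif_pos]
    have h₁ := hmul ⟨a, ha⟩ ⟨b, hb⟩ (c ⟨a * b, hab⟩) (add_sub_cancel (a * b) 1)
    rw [e13, e23] at h₁
    linear_combination hadd ⟨a * b, hab⟩ - h₁

/-- A finite subset of a ring gives a sum-network that is solvable over a field if the ring has a
homomorphism to this field, and only if the subset has a partial homomorphism to it. -/
theorem exists_sumNetwork {R : Type} [CommRing R] {Q : Set R} [Finite Q] (h1 : 1 ∈ Q)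
    (hQ : ∀ a ∈ Q, 1 - a ∈ Q) :
    ∃ (V E : Type) (_ : Fintype V) (_ : Fintype E) (N : SumNetwork V E), ∀ (F : Type u) [Field F],
      (N.ScalarLinearSolvable F → ∃ y : R → F, IsPartialRingHom Q y) ∧
        ((R →+* F) → N.ScalarLinearSolvable F) := by
  classical
  let D := ArithSignal.layout ((↑) : Q → R)
  have := ArithSignal.nonempty_tests ((↑) : Q → R)
  have : Fintype (ArithSignal Q) := Fintype.ofFinite _
  have : Fintype (ArithSignal.tests ((↑) : Q → R)) := Fintype.ofFinite _
  have : ∀ k, Fintype (D.inp k) := fun k => Fintype.ofFinite _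
  refine ⟨_, D.Edge, inferInstance, inferInstance, D.network, fun F _ => ⟨?_, fun φ => ?_⟩⟩
  · rintro ⟨c, hc⟩
    obtain ⟨f, hf⟩ := D.exists_realizes_of_isSolution hc
    exact ArithSignal.exists_isPartialRingHom h1 hQ hf
  · exact ((ArithSignal.realizes_generic ((↑) : Q → R)).map φ).scalarLinearSolvable

theorem mainTheorem2 (n : ℕ) (P : Set (MvPolynomial (Fin n) ℤ)) :
    ∃ (V E : Type) (_ : Fintype V) (_ : Fintype E) (N : SumNetwork V E),
      ∀ (F : Type*) [Field F] [Finite F],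
        N.ScalarLinearSolvable F ↔ ∃ x : Fin n → F, ∀ p ∈ P, MvPolynomial.aeval x p = 0 := by
  classical
  obtain ⟨Q₀, hQ₀⟩ := exists_finset_solution P
  -- The tests express relations as sums equal to 1, so `Q` is closed under the involution `a ↦ 1 -
  -- a`.
  let Q := insert 1 Q₀ ∪ (insert 1 Q₀).image (fun a => 1 - a)
  have hQ : ∀ a ∈ (Q : Set (MvPolynomial (Fin n) ℤ ⧸ Ideal.span P)), 1 - a ∈ (Q : Set _) := by
    intro a ha
    rcases Finset.mem_union.1 ha with ha | ha
    · exact Finset.mem_union_right _ (Finset.mem_image_of_mem _ ha)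
    · obtain ⟨b, hb, rfl⟩ := Finset.mem_image.1 ha
      rw [sub_sub_cancel]
      exact Finset.mem_union_left _ hb
  obtain ⟨V, E, hV, hE, N, hN⟩ := exists_sumNetwork (by simp [Q]) hQ
  refine ⟨V, E, hV, hE, N, fun F _ _ => ⟨fun h => ?_, fun ⟨x, hx⟩ => ?_⟩⟩
  · obtain ⟨y, hy⟩ := (hN F).1 h
    exact hQ₀ F y (hy.mono fun a ha =>
      Finset.mem_union_left _ (Finset.mem_insert_of_mem ha))
  · refine (hN F).2 (Ideal.Quotient.lift (Ideal.span P) (MvPolynomial.aeval x).toRingHom ?_)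
    have hle : Ideal.span P ≤ RingHom.ker (MvPolynomial.aeval x).toRingHom :=
      Ideal.span_le.2 hx
    exact fun p hp => hle hp
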